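/- For $n\ge 1$ let $P_n=\sum_{i=1}^n i^2$ be the $n$-th square pyramidal number, let $y_n^2$ be the perfect square closest to $P_n$ (it is unique), and let $a_n=|P_n-y_n^2|$. For every positive integer $k$ and real $x\ge 1$ put $M_k(x)=\sum_{1\le n\le x}a_n^k$. Then for every positive integer $k$, $$M_k(x)=\frac{x^{\frac32k+1}}{3^{k/2}\left(\frac32k+1\right)(k+1)}+O_k\left(x^{\frac32k+\frac{11}{12}}\right),$$ that is, there is a constant $C_k>0$ depending only on $k$ such that for all real $x\ge 1$ the difference between $M_k(x)$ and the main term is at most $C_k\,x^{\frac32k+\frac{11}{12}}$ in absolute value. -/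

import Mathlib

namespace Cannonball

/-- The `n`-th square pyramidal number `1² + 2² + ⋯ + n²`. -/
def pyramidal (n : ℕ) : ℕ := ∑ i ∈ Finset.Icc 1 n, i ^ 2

/-- `s` is a perfect square at minimal distance from `N` among all perfect squares. -/
def IsClosestSquare (N s : ℕ) : Prop :=
  IsSquare s ∧ ∀ t : ℕ, IsSquare t → |(N : ℤ) - s| ≤ |(N : ℤ) - t|

/-- Every natural number has exactly one closest perfect square: a tie would have to be between two
consecutive squares, and these have different parities. -/
theorem existsUnique_isClosestSquare (N : ℕ) : ∃! s, IsClosestSquare N s := by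
  have hex : ∃ s, IsClosestSquare N s := by
    obtain ⟨r, hr⟩ : ∃ r : ℕ, ∀ t : ℕ,
        ((N : ℤ) - (r * r : ℕ)).natAbs ≤ ((N : ℤ) - (t * t : ℕ)).natAbs := by
      obtain ⟨r, -, hr⟩ := WellFounded.has_min
        (measure fun t : ℕ => ((N : ℤ) - (t * t : ℕ)).natAbs).wf Set.univ ⟨0, trivial⟩
      exact ⟨r, fun t => not_lt.1 (hr t trivial)⟩
    refine ⟨r * r, ⟨r, rfl⟩, ?_⟩
    rintro _ ⟨t, rfl⟩
    rw [Int.abs_eq_natAbs, Int.abs_eq_natAbs]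
    exact_mod_cast hr t
  have key : ∀ u v : ℕ, IsClosestSquare N (u * u) → IsClosestSquare N (v * v) → ¬ u < v := by
    intro u v hu hv huv
    have h1 := hu.2 _ ⟨v, rfl⟩
    have h2 := hv.2 _ ⟨u, rfl⟩
    have h3 := hu.2 _ ⟨u + 1, rfl⟩
    have h4 : (u + 1) * (u + 1) ≤ v * v := Nat.mul_le_mul huv huv
    have h5 : (u + 1) * (u + 1) = u * u + 2 * u + 1 := by ring
    rw [h5] at h3 h4
    generalize u * u = p at *
    generalize v * v = q at *
    push_cast at *
    grind
  obtain ⟨s, hs⟩ := hex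
  refine ⟨s, hs, fun t ht => ?_⟩
  obtain ⟨u, rfl⟩ := hs.1
  obtain ⟨v, rfl⟩ := ht.1
  have := key u v hs ht
  have := key v u ht hs
  have : u = v := by omega
  rw [this]

/-- The perfect square closest to `N`. -/
noncomputable def closestSquare (N : ℕ) : ℕ := (existsUnique_isClosestSquare N).choose

/-- The distance `a n` from the `n`-th square pyramidal number to the closest perfect square. -/
noncomputable def a (n : ℕ) : ℤ := |(pyramidal n : ℤ) - closestSquare (pyramidal n)|

/-- The `k`-th moment `∑_{1 ≤ n ≤ x} (a n) ^ k`. -/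
noncomputable def moment (k : ℕ) (x : ℝ) : ℝ := ∑ n ∈ Finset.Icc 1 ⌊x⌋₊, (a n : ℝ) ^ k

end Cannonball

/-! With `m = n + 1/2` one has `P_n = m³/3 - m/12`, so `√P_n` is very close to `u n = m^(3/2)/√3`.
Writing `‖t‖` for the distance from `t` to the nearest integer, the distance from `y²` to the
closest square is `2y‖y‖ + O(1)`, hence `a n = 2 u(n) ‖u(n)‖ + O(n)`. The moment thus becomes a sum
of `(2u)^k ‖u‖^k`. If `u` is equidistributed modulo 1, then `‖u‖^k` may be replaced by its mean
`1/(2^k (k+1))`, and the main term is a sum of powers of `n + 1/2`.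

The error comes from equidistribution. The Fourier coefficients of `‖t‖^k` are `O(h⁻²)`, so a bound
`O(√h N^(11/12))` for the sums of `e(h u(n))` leaves the convergent series of `h^(-3/2)`
(`exists_sum_distPow_u_le`). That bound (`norm_sum_e_mul_u_le`) takes one van der Corput
differencing step with `H ≈ N^(1/6)` shifts (`norm_sum_le_of_correlation_le`). The differenced phase
has positive decreasing increments, made of second differences of `u` of size about `n^(-1/2)`, so
the Kuzmin–Landau inequality (`norm_sum_e_le_of_antitone`) bounds the correlations by `O(√N)`.
Partial summation restores the weights `(2u)^k`. -/

namespace Cannonball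

/-! ### Kuzmin–Landau and van der Corput inequalities -/

open Finset Complex

/-- The additive character `x ↦ exp (2πix)`. -/
noncomputable def e (x : ℝ) : ℂ := Complex.exp (2 * Real.pi * x * Complex.I)

theorem e_add (x y : ℝ) : e (x + y) = e x * e y := by
  simp only [e, ← Complex.exp_add]
  congr 1
  push_cast
  ring

theorem norm_e (x : ℝ) : ‖e x‖ = 1 := by
  have : (2 * Real.pi * x * Complex.I : ℂ) = ((2 * Real.pi * x : ℝ) : ℂ) * Complex.I := by
    push_cast; ring
  rw [e, this, Complex.norm_exp_ofReal_mul_I]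

theorem conj_e (x : ℝ) : (starRingEnd ℂ) (e x) = e (-x) := by
  simp only [e, ← Complex.exp_conj]
  congr 1
  simp only [map_mul, Complex.conj_ofReal, Complex.conj_I, Complex.conj_ofNat]
  push_cast
  ring

theorem norm_e_sub_one (x : ℝ) : ‖e x - 1‖ = |2 * Real.sin (Real.pi * x)| := by
  have h := Complex.norm_exp_I_mul_ofReal_sub_one (2 * Real.pi * x)
  have h2 : (2 * Real.pi * x * Complex.I : ℂ) = Complex.I * ((2 * Real.pi * x : ℝ) : ℂ) := by
    push_cast; ring
  rw [e, h2, h, Real.norm_eq_abs]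
  congr 3
  ring

theorem norm_e_sub_le (x y : ℝ) : ‖e x - e y‖ ≤ 2 * Real.pi * |x - y| := by
  have h : e x - e y = (e (x - y) - 1) * e y := by
    rw [sub_mul, ← e_add, sub_add_cancel, one_mul]
  have h2 : |Real.sin (Real.pi * (x - y))| ≤ Real.pi * |x - y| := by
    refine Real.abs_sin_le_abs.trans ?_
    rw [abs_mul, abs_of_pos Real.pi_pos]
  rw [h, norm_mul, norm_e, mul_one, norm_e_sub_one, abs_mul, abs_two]
  linarith

theorem four_mul_le_norm_e_sub_one {x : ℝ} (h0 : 0 ≤ x) (h1 : x ≤ 1 / 2) :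
    4 * x ≤ ‖e x - 1‖ := by
  have hpi := Real.pi_pos
  have h := Real.mul_le_sin (x := Real.pi * x) (by positivity) (by nlinarith)
  have h2 : 2 / Real.pi * (Real.pi * x) = 2 * x := by field_simp
  rw [norm_e_sub_one]
  refine le_trans ?_ (le_abs_self _)
  linarith

theorem norm_inv_e_sub_one_le {x : ℝ} (h0 : 0 < x) (h1 : x ≤ 1 / 2) :
    ‖(e x - 1)⁻¹‖ ≤ 1 / (4 * x) := by
  rw [norm_inv, ← one_div]
  exact one_div_le_one_div_of_le (by positivity) (four_mul_le_norm_e_sub_one h0.le h1)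

/-- The bound is a difference of values of `1/x`, so it telescopes along a decreasing sequence of
increments. -/
theorem norm_inv_e_sub_one_sub_le {x y : ℝ} (h0 : 0 < y) (hyx : y ≤ x) (h1 : x ≤ 1 / 2) :
    ‖(e x - 1)⁻¹ - (e y - 1)⁻¹‖ ≤ Real.pi / 8 * (1 / y - 1 / x) := by
  have hx0 : 0 < x := h0.trans_le hyx
  have hx := four_mul_le_norm_e_sub_one hx0.le h1
  have hy := four_mul_le_norm_e_sub_one h0.le (hyx.trans h1)
  have hx' : e x - 1 ≠ 0 := norm_pos_iff.1 (by linarith)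
  have hy' : e y - 1 ≠ 0 := norm_pos_iff.1 (by linarith)
  have h := norm_e_sub_le y x
  rw [abs_sub_comm, abs_of_nonneg (sub_nonneg.2 hyx)] at h
  have : (e x - 1)⁻¹ - (e y - 1)⁻¹ = (e y - e x) / ((e x - 1) * (e y - 1)) := by
    field_simp
    ring
  rw [this, norm_div, norm_mul]
  have hpi := Real.pi_pos
  calc ‖e y - e x‖ / (‖e x - 1‖ * ‖e y - 1‖)
      ≤ 2 * Real.pi * (x - y) / (4 * x * (4 * y)) := by
        gcongr
    _ = Real.pi / 8 * (1 / y - 1 / x) := by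
        field_simp
        ring

/-- A form of the Kuzmin–Landau inequality: if the increments of `g` are positive, decreasing and
at most `1 / 2`, the exponential sum of `g` is at most the reciprocal of the last increment. -/
theorem norm_sum_e_le_of_antitone (g : ℕ → ℝ) (M L : ℕ)
    (hanti : ∀ n, M ≤ n → g (n + 2) - g (n + 1) ≤ g (n + 1) - g n)
    (hpos : ∀ n, M ≤ n → 0 < g (n + 1) - g n)
    (hle : ∀ n, M ≤ n → g (n + 1) - g n ≤ 1 / 2) :
    ‖∑ i ∈ range (L + 1), e (g (M + i))‖ ≤ 1 / (g (M + L + 1) - g (M + L)) := by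
  set d : ℕ → ℝ := fun i => g (M + i + 1) - g (M + i) with hd
  set c : ℕ → ℂ := fun i => (e (d i) - 1)⁻¹ with hc
  have hdpos : ∀ i, 0 < d i := fun i => hpos _ (by omega)
  have hdle : ∀ i, d i ≤ 1 / 2 := fun i => hle _ (by omega)
  have hpi := Real.pi_pos
  have hne : ∀ i, e (d i) - 1 ≠ 0 := fun i =>
    norm_pos_iff.1 (by linarith [four_mul_le_norm_e_sub_one (hdpos i).le (hdle i), hdpos i])
  -- Each term is a difference, `e(g_i) = c_i (e(g_{i+1}) - e(g_i))`, which prepares a summation by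
  -- parts.
  have hstep : ∀ i, e (g (M + i)) - c i * e (g (M + (i + 1))) = - (c i * e (g (M + i))) := by
    intro i
    have h1 : g (M + (i + 1)) = d i + g (M + i) := by simp [hd, add_assoc]
    have h2 : c i * (e (d i) - 1) = 1 := inv_mul_cancel₀ (hne i)
    rw [h1, e_add]
    linear_combination (-e (g (M + i))) * h2
  have key : ∀ l : ℕ, ‖∑ i ∈ range (l + 1), e (g (M + i)) - c l * e (g (M + (l + 1)))‖
      ≤ 1 / (4 * d 0) + Real.pi / 8 * (1 / d l - 1 / d 0) := by
    intro l
    induction l with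
    | zero =>
      rw [sum_range_one, hstep, norm_neg, norm_mul, norm_e, mul_one, sub_self, mul_zero, add_zero]
      exact norm_inv_e_sub_one_le (hdpos 0) (hdle 0)
    | succ l ih =>
      have h1 : ∑ i ∈ range (l + 1 + 1), e (g (M + i)) - c (l + 1) * e (g (M + (l + 1 + 1)))
          = (∑ i ∈ range (l + 1), e (g (M + i)) - c l * e (g (M + (l + 1))))
            + (c l - c (l + 1)) * e (g (M + (l + 1))) := by
        rw [sum_range_succ]
        linear_combination hstep (l + 1)
      have h2 : ‖c l - c (l + 1)‖ ≤ Real.pi / 8 * (1 / d (l + 1) - 1 / d l) :=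
        norm_inv_e_sub_one_sub_le (hdpos _) (hanti (M + l) (by omega)) (hdle _)
      rw [h1]
      refine (norm_add_le _ _).trans ?_
      rw [norm_mul, norm_e, mul_one]
      linarith
  have hlast : ‖c L * e (g (M + (L + 1)))‖ ≤ 1 / (4 * d L) := by
    rw [norm_mul, norm_e, mul_one]
    exact norm_inv_e_sub_one_le (hdpos L) (hdle L)
  have hd0 : 1 / d 0 ≤ 1 / d L := by
    refine one_div_le_one_div_of_le (hdpos L) ?_
    exact antitone_nat_of_succ_le (f := d) (fun n => hanti (M + n) (by omega)) (Nat.zero_le L)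
  have h0 : 0 < 1 / d 0 := by have := hdpos 0; positivity
  have hsum := norm_add_le
    (∑ i ∈ range (L + 1), e (g (M + i)) - c L * e (g (M + (L + 1)))) (c L * e (g (M + (L + 1))))
  rw [sub_add_cancel] at hsum
  have h4 : ∀ x : ℝ, 1 / (4 * x) = 1 / 4 * (1 / x) := fun x => by rw [one_div_mul_one_div]
  have hk := key L
  rw [h4] at hk hlast
  have := Real.pi_lt_four
  -- Since `π/8 < 1/2`, the three pieces are at most `(1/4)/d 0 + (1/2)(1/d L - 1/d 0) + (1/4)/d L ≤
  -- 1/d L`.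
  have hfin : ‖∑ i ∈ range (L + 1), e (g (M + i))‖ ≤ 1 / d L := by nlinarith
  exact hfin

/-- Each unit shift drops one term and gains another, both of modulus one. -/
theorem norm_sum_shift_sub_sum_le {z : ℕ → ℂ} (hz : ∀ n, ‖z n‖ = 1) (L j : ℕ) :
    ‖∑ i ∈ range L, z (i + j) - ∑ i ∈ range L, z i‖ ≤ 2 * j := by
  induction j with
  | zero => simp
  | succ j ih =>
    have h : ∑ i ∈ range L, z (i + (j + 1)) = ∑ i ∈ range L, z (i + j) + (z (L + j) - z j) := by
      have h1 := sum_range_succ (fun i => z (i + j)) L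
      have h2 := sum_range_succ' (fun i => z (i + j)) L
      simp only [zero_add] at h2
      have h3 : ∀ i, i + 1 + j = i + (j + 1) := fun i => by ring
      simp only [h3] at h2
      linear_combination h1 - h2
    rw [h, add_sub_right_comm]
    refine (norm_add_le _ _).trans ?_
    have := norm_sub_le (z (L + j)) (z j)
    rw [hz, hz] at this
    push_cast
    linarith

/-- The Weyl–van der Corput inequality for a sequence of complex numbers of modulus one. -/
theorem norm_sum_le_of_correlation_le {z : ℕ → ℂ} (hz : ∀ n, ‖z n‖ = 1) (L H : ℕ) (hH : 0 < H)
    {B : ℝ} (hB : 0 ≤ B) (hcor : ∀ j j', j' < j → j < H →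
      ‖∑ i ∈ range L, z (i + j) * (starRingEnd ℂ) (z (i + j'))‖ ≤ B) :
    ‖∑ i ∈ range L, z i‖ ≤ 2 * H + √((L : ℝ) ^ 2 / H + L * B) := by
  have hcor' : ∀ j ∈ range H, ∀ j' ∈ range H,
      ‖∑ i ∈ range L, z (i + j) * (starRingEnd ℂ) (z (i + j'))‖ ≤ (if j = j' then (L : ℝ) else 0)
        + B := by
    intro j hj j' hj'
    rw [mem_range] at hj hj'
    rcases lt_trichotomy j' j with h | h | h
    · rw [if_neg h.ne', zero_add]
      exact hcor j j' h hj
    · subst h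
      rw [if_pos rfl]
      refine (norm_sum_le _ _).trans ?_
      simp [hz, hB]
    · rw [if_neg h.ne, zero_add, ← Complex.norm_conj, map_sum]
      refine le_of_eq_of_le ?_ (hcor j' j h hj')
      congr 1
      refine sum_congr rfl fun i _ => ?_
      rw [map_mul, Complex.conj_conj, mul_comm]
  have hH' : (0 : ℝ) < H := by exact_mod_cast hH
  set S := ∑ i ∈ range L, z i with hS
  set w : ℕ → ℂ := fun i => ∑ j ∈ range H, z (i + j) with hw
  -- Averaging over `H` shifts replaces `H * S` by the sum of the short sums `w i`.
  have hdiff : ‖∑ i ∈ range L, w i - H * S‖ ≤ 2 * (H : ℝ) ^ 2 := by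
    have h1 : ∑ i ∈ range L, w i - H * S
        = ∑ j ∈ range H, (∑ i ∈ range L, z (i + j) - S) := by
      rw [sum_sub_distrib, sum_const, card_range, nsmul_eq_mul, sum_comm]
    rw [h1]
    refine (norm_sum_le _ _).trans ?_
    calc ∑ j ∈ range H, ‖∑ i ∈ range L, z (i + j) - S‖ ≤ ∑ _j ∈ range H, 2 * (H : ℝ) := by
          refine sum_le_sum fun j hj => (norm_sum_shift_sub_sum_le hz L j).trans ?_
          have : (j : ℝ) ≤ H := by exact_mod_cast (mem_range.1 hj).le
          linarith
      _ = 2 * (H : ℝ) ^ 2 := by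
          rw [sum_const, card_range, nsmul_eq_mul]
          ring
  -- Opening the square gives `H` diagonal terms of size `L`, and off-diagonal correlations bounded
  -- by `B`.
  have hsq : ∑ i ∈ range L, ‖w i‖ ^ 2 ≤ H * L + (H : ℝ) ^ 2 * B := by
    have h1 : ((∑ i ∈ range L, ‖w i‖ ^ 2 : ℝ) : ℂ)
        = ∑ j ∈ range H, ∑ j' ∈ range H,
            ∑ i ∈ range L, z (i + j) * (starRingEnd ℂ) (z (i + j')) := by
      push_cast
      have h2 : ∀ i, ((‖w i‖ : ℂ)) ^ 2
          = ∑ j ∈ range H, ∑ j' ∈ range H, z (i + j) * (starRingEnd ℂ) (z (i + j')) := by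
        intro i
        rw [← Complex.mul_conj', hw, map_sum, sum_mul_sum]
      simp only [h2]
      rw [sum_comm]
      exact sum_congr rfl fun j _ => sum_comm
    calc ∑ i ∈ range L, ‖w i‖ ^ 2 ≤ ‖((∑ i ∈ range L, ‖w i‖ ^ 2 : ℝ) : ℂ)‖ := by
          rw [Complex.norm_real]; exact Real.le_norm_self _
      _ ≤ ∑ j ∈ range H, ∑ j' ∈ range H, ((if j = j' then (L : ℝ) else 0) + B) := by
          rw [h1]
          refine (norm_sum_le _ _).trans (sum_le_sum fun j hj => ?_)
          exact (norm_sum_le _ _).trans (sum_le_sum fun j' hj' => hcor' j hj j' hj')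
      _ = H * L + (H : ℝ) ^ 2 * B := by
          have : ∀ j ∈ range H, ∑ j' ∈ range H, ((if j = j' then (L : ℝ) else 0) + B)
              = L + H * B := by
            intro j hj
            rw [sum_add_distrib, sum_ite_eq, if_pos hj]
            simp
          rw [sum_congr rfl this, sum_const, card_range, nsmul_eq_mul]
          ring
  have hW : ‖∑ i ∈ range L, w i‖ ≤ H * √((L : ℝ) ^ 2 / H + L * B) := by
    refine (norm_sum_le _ _).trans ?_
    have h1 := sq_sum_le_card_mul_sum_sq (s := range L) (f := fun i => ‖w i‖)
    rw [card_range] at h1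
    have h2 : (H : ℝ) * √((L : ℝ) ^ 2 / H + L * B) = √(L * (H * L + (H : ℝ) ^ 2 * B)) := by
      have : (L : ℝ) * (H * L + (H : ℝ) ^ 2 * B) = (H : ℝ) ^ 2 * ((L : ℝ) ^ 2 / H + L * B) := by
        field_simp
      rw [this, Real.sqrt_mul (by positivity), Real.sqrt_sq hH'.le]
    rw [h2]
    refine Real.le_sqrt_of_sq_le (h1.trans ?_)
    exact mul_le_mul_of_nonneg_left hsq (Nat.cast_nonneg L)
  have hfin : (H : ℝ) * ‖S‖ ≤ H * (2 * H + √((L : ℝ) ^ 2 / H + L * B)) := by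
    have h1 : (H : ℝ) * ‖S‖ = ‖(H : ℂ) * S‖ := by simp
    have h2 := norm_sub_le (∑ i ∈ range L, w i) (∑ i ∈ range L, w i - H * S)
    rw [sub_sub_cancel] at h2
    rw [h1]
    nlinarith
  exact le_of_mul_le_mul_left hfin hH'

end Cannonball

/-! ### Second differences of `u` and the correlation bound -/

namespace Cannonball

open Finset Complex

/-- The function `t ↦ t ^ (3 / 2) / √3`, whose value at `n + 1 / 2` approximates the square root of
the `n`-th square pyramidal number. -/
noncomputable def rootApprox (t : ℝ) : ℝ := t * √t / √3

theorem hasDerivAt_rootApprox {t : ℝ} (ht : 0 < t) :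
    HasDerivAt rootApprox (√3 / 2 * √t) t := by
  have h := ((hasDerivAt_id t).mul (Real.hasDerivAt_sqrt ht.ne')).div_const (√3)
  refine h.congr_deriv ?_
  have h3 : (0 : ℝ) < √3 := by positivity
  have h4 : (0 : ℝ) < √t := by positivity
  have h5 := Real.sq_sqrt (show (0 : ℝ) ≤ 3 by norm_num)
  have h6 := Real.sq_sqrt ht.le
  simp only [id]
  field_simp
  rw [h5, h6]
  ring

/-- The second difference of `rootApprox`. -/
noncomputable def secondDiff (t : ℝ) : ℝ :=
  rootApprox (t + 2) - 2 * rootApprox (t + 1) + rootApprox t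

theorem hasDerivAt_rootApprox_add {t c : ℝ} (ht : 0 < t) (hc : 0 ≤ c) :
    HasDerivAt (fun t => rootApprox (t + c)) (√3 / 2 * √(t + c)) t :=
  (hasDerivAt_rootApprox (by linarith)).comp_add_const t c

theorem hasDerivAt_secondDiff {t : ℝ} (ht : 0 < t) :
    HasDerivAt secondDiff (√3 / 2 * (√(t + 2) - 2 * √(t + 1) + √t)) t := by
  have h := ((hasDerivAt_rootApprox_add ht zero_le_two).sub
    ((hasDerivAt_rootApprox_add ht zero_le_one).const_mul 2)).add (hasDerivAt_rootApprox ht)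
  refine h.congr_deriv ?_
  ring

theorem sqrt_add_two_add_sqrt_le {t : ℝ} (ht : 0 ≤ t) : √(t + 2) + √t ≤ 2 * √(t + 1) := by
  have h1 := Real.sq_sqrt ht
  have h2 := Real.sq_sqrt (show 0 ≤ t + 1 by linarith)
  have h3 := Real.sq_sqrt (show 0 ≤ t + 2 by linarith)
  refine abs_le_of_sq_le_sq' ?_ (by positivity) |>.2
  nlinarith [sq_nonneg (√(t + 2) - √t)]

/-- The derivative is a multiple of the second difference of the square root, nonpositive by
concavity. -/
theorem secondDiff_add_one_le {t : ℝ} (ht : 0 < t) : secondDiff (t + 1) ≤ secondDiff t := by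
  have h : AntitoneOn secondDiff (Set.Ioi 0) := by
    refine antitoneOn_of_deriv_nonpos (convex_Ioi 0)
      (fun x hx => (hasDerivAt_secondDiff hx).continuousAt.continuousWithinAt) ?_ ?_
    · rw [interior_Ioi]
      exact fun x hx => (hasDerivAt_secondDiff hx).differentiableAt.differentiableWithinAt
    · rw [interior_Ioi]
      intro x hx
      rw [(hasDerivAt_secondDiff hx).deriv]
      have := sqrt_add_two_add_sqrt_le (le_of_lt hx)
      have h3 : (0 : ℝ) < √3 := by positivity
      nlinarith
  exact h ht (show (0 : ℝ) < t + 1 by linarith) (by linarith)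

theorem exists_secondDiff_eq {t : ℝ} (ht : 0 < t) :
    ∃ ξ, t < ξ ∧ ξ < t + 1 ∧ secondDiff t = √3 / 2 * (√(ξ + 1) - √ξ) := by
  have hd : ∀ x, 0 < x → HasDerivAt (fun x => rootApprox (x + 1) - rootApprox x)
      (√3 / 2 * √(x + 1) - √3 / 2 * √x) x := fun x hx =>
    (hasDerivAt_rootApprox_add hx zero_le_one).sub (hasDerivAt_rootApprox hx)
  obtain ⟨ξ, ⟨h1, h2⟩, h3⟩ := exists_hasDerivAt_eq_slope _ _ (show t < t + 1 by linarith)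
    (fun x hx => (hd x (ht.trans_le hx.1)).continuousAt.continuousWithinAt)
    (fun x hx => hd x (ht.trans hx.1))
  refine ⟨ξ, h1, h2, ?_⟩
  rw [add_sub_cancel_left, div_one] at h3
  rw [mul_sub, h3, secondDiff, show t + 1 + 1 = t + 2 by ring]
  ring

theorem secondDiff_le {t : ℝ} (ht : 0 < t) : secondDiff t ≤ 1 / (2 * √t) := by
  obtain ⟨ξ, h1, -, h3⟩ := exists_secondDiff_eq ht
  have ht' : 0 < √t := Real.sqrt_pos.2 ht
  have hle := Real.sqrt_le_sqrt h1.le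
  have hle' := Real.sqrt_le_sqrt (show ξ ≤ ξ + 1 by linarith)
  have h4 := Real.sq_sqrt (show 0 ≤ ξ by linarith)
  have h5 := Real.sq_sqrt (show 0 ≤ ξ + 1 by linarith)
  have h6 : √3 / 2 ≤ 1 := by
    have : √3 ≤ √4 := Real.sqrt_le_sqrt (by norm_num)
    have h4 : √(4 : ℝ) = 2 := by rw [show (4 : ℝ) = 2 ^ 2 by norm_num, Real.sqrt_sq zero_le_two]
    linarith
  rw [h3, le_div_iff₀ (by positivity)]
  have h7 : (√(ξ + 1) - √ξ) * (2 * √t) ≤ 1 := by nlinarith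
  have h8 : 0 ≤ (√(ξ + 1) - √ξ) * (2 * √t) := by
    have := sub_nonneg.2 hle'
    positivity
  nlinarith

/-- The constant comes from `√(ξ+1) - √ξ ≥ 1/(2√(t+2))` and `√3 ≥ 8/5`. -/
theorem le_secondDiff {t : ℝ} (ht : 0 < t) : 2 / (5 * √(t + 2)) ≤ secondDiff t := by
  obtain ⟨ξ, h1, h2, h3⟩ := exists_secondDiff_eq ht
  have hξ : 0 < √ξ := Real.sqrt_pos.2 (by linarith)
  have hle := Real.sqrt_le_sqrt (show ξ + 1 ≤ t + 2 by linarith)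
  have hle' := Real.sqrt_le_sqrt (show ξ ≤ ξ + 1 by linarith)
  have h4 := Real.sq_sqrt (show 0 ≤ ξ by linarith)
  have h5 := Real.sq_sqrt (show 0 ≤ ξ + 1 by linarith)
  have h6 : 8 / 5 ≤ √3 := Real.le_sqrt_of_sq_le (by norm_num)
  rw [h3, div_le_iff₀ (by linarith)]
  have h7 : 1 ≤ (√(ξ + 1) - √ξ) * (2 * √(t + 2)) := by nlinarith
  nlinarith

theorem secondDiff_pos {t : ℝ} (ht : 0 < t) : 0 < secondDiff t :=
  lt_of_lt_of_le (by positivity) (le_secondDiff ht)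

/-- The approximation to the square root of the `n`-th square pyramidal number. -/
noncomputable def u (n : ℕ) : ℝ := rootApprox (n + 1 / 2)

theorem u_second_difference (n : ℕ) : u (n + 2) - u (n + 1) - (u (n + 1) - u n)
    = secondDiff (n + 1 / 2) := by
  simp only [u, secondDiff]
  push_cast
  ring_nf

/-- By telescoping, the increments of the differenced phase inherit positivity, monotonicity and
size from `secondDiff`. -/
theorem first_difference_u_sub (n j r : ℕ) :
    (u (n + 1 + (j + r)) - u (n + 1 + j)) - (u (n + (j + r)) - u (n + j))
      = ∑ i ∈ range r, secondDiff ((n + j + i : ℕ) + 1 / 2) := by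
  induction r with
  | zero => simp
  | succ r ih =>
    rw [sum_range_succ, ← ih, ← u_second_difference]
    have h1 : n + 1 + (j + (r + 1)) = n + j + r + 2 := by ring
    have h2 : n + (j + (r + 1)) = n + j + r + 1 := by ring
    have h3 : n + 1 + (j + r) = n + j + r + 1 := by ring
    have h4 : n + (j + r) = n + j + r := by ring
    rw [h1, h2, h3, h4]
    ring

/-- The correlation bound for the exponential sums of `u`. -/
theorem norm_sum_correlation_le {h : ℝ} (hh : 1 ≤ h) {M H : ℕ} (hM : (h * H) ^ 2 ≤ M) (hM0 : 0 < M)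
    (L : ℕ) {j j' : ℕ} (hj : j' < j) (hjH : j < H) :
    ‖∑ i ∈ range L, e (h * u (M + (i + j))) * (starRingEnd ℂ) (e (h * u (M + (i + j'))))‖
      ≤ 5 / 2 * √(M + L + H) := by
  obtain ⟨r, rfl⟩ := Nat.exists_eq_add_of_lt hj
  rcases L with - | L
  · simp only [range_zero, sum_empty, norm_zero]
    positivity
  set g : ℕ → ℝ := fun n => h * (u (n + (j' + (r + 1))) - u (n + j')) with hg
  have hh0 : 0 < h := by linarith
  have hd : ∀ n, g (n + 1) - g n
      = h * ∑ i ∈ range (r + 1), secondDiff ((n + j' + i : ℕ) + 1 / 2) := by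
    intro n
    rw [← first_difference_u_sub]
    simp only [hg]
    ring
  have hpos : ∀ n : ℕ, 0 < ((n : ℕ) : ℝ) + 1 / 2 := fun n => by positivity
  have hle := norm_sum_e_le_of_antitone g M L ?_ ?_ ?_
  · have hsum : ∀ i, e (h * u (M + (i + (j' + r + 1))))
        * (starRingEnd ℂ) (e (h * u (M + (i + j')))) = e (g (M + i)) := by
      intro i
      rw [conj_e, ← e_add, hg]
      congr 1
      simp only [← add_assoc]
      ring
    simp only [hsum]
    refine hle.trans ?_
    -- For the lower bound on the last increment, one second difference suffices; the others are
    -- positive and `h ≥ 1`.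
    rw [hd, sum_range_succ']
    have h1 : 0 ≤ ∑ i ∈ range r, secondDiff ((M + L + j' + (i + 1) : ℕ) + 1 / 2) :=
      sum_nonneg fun i _ => (secondDiff_pos (hpos _)).le
    have h2 := le_secondDiff (hpos (M + L + j' + 0))
    have h3 : √(((M + L + j' + 0 : ℕ) : ℝ) + 1 / 2 + 2) ≤ √(M + (L + 1 : ℕ) + H) := by
      refine Real.sqrt_le_sqrt ?_
      have : (j' : ℝ) + 2 ≤ H := by exact_mod_cast (show j' + 2 ≤ H by omega)
      push_cast
      linarith
    have h4 : 0 < √(((M + L + j' + 0 : ℕ) : ℝ) + 1 / 2 + 2) := by positivity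
    have h5 : 2 / (5 * √(M + (L + 1 : ℕ) + H))
        ≤ 2 / (5 * √(((M + L + j' + 0 : ℕ) : ℝ) + 1 / 2 + 2)) := by gcongr
    have h6 : 0 < √((M : ℝ) + (L + 1 : ℕ) + H) := h4.trans_le h3
    have h7 : 0 < 2 / (5 * √((M : ℝ) + (L + 1 : ℕ) + H)) := by positivity
    have h8 : 5 / 2 * √((M : ℝ) + (L + 1 : ℕ) + H)
        = 1 / (2 / (5 * √((M : ℝ) + (L + 1 : ℕ) + H))) := by
      rw [one_div_div]
      ring
    rw [h8]
    refine one_div_le_one_div_of_le h7 ?_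
    nlinarith
  · intro n hn
    rw [hd, hd]
    refine mul_le_mul_of_nonneg_left (sum_le_sum fun i _ => ?_) hh0.le
    have := secondDiff_add_one_le (hpos (n + j' + i))
    refine le_of_eq_of_le ?_ this
    congr 1
    push_cast
    ring
  · intro n hn
    rw [hd]
    exact mul_pos hh0 (sum_pos (fun i _ => secondDiff_pos (hpos _)) (by simp))
  · intro n hn
    rw [hd]
    -- At most `H` second differences, each at most `1/(2√M)`, give an increment at most `hH/(2√M) ≤
    -- 1/2`; this is why `M` must be at least `(hH)²`.
    have hMs : 0 < √(M : ℝ) := Real.sqrt_pos.2 (by exact_mod_cast hM0)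
    have h1 : ∀ i ∈ range (r + 1), secondDiff ((n + j' + i : ℕ) + 1 / 2) ≤ 1 / (2 * √M) := by
      intro i _
      refine (secondDiff_le (hpos _)).trans ?_
      gcongr
      have : (M : ℝ) ≤ (n + j' + i : ℕ) := by exact_mod_cast (show M ≤ n + j' + i by omega)
      linarith
    have h2 := sum_le_sum h1
    rw [sum_const, card_range, nsmul_eq_mul] at h2
    have h3 : ((r + 1 : ℕ) : ℝ) ≤ H := by exact_mod_cast (show r + 1 ≤ H by omega)
    have h4 : h * H ≤ √M := Real.le_sqrt_of_sq_le hM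
    calc _ ≤ h * (((r + 1 : ℕ) : ℝ) * (1 / (2 * √M))) := by gcongr
      _ ≤ h * (H * (1 / (2 * √M))) := by gcongr
      _ = h * H / √M * (1 / 2) := by field_simp
      _ ≤ 1 * (1 / 2) := by gcongr; exact (div_le_one hMs).2 h4
      _ = 1 / 2 := one_mul _

end Cannonball

/-! ### The exponential sum bound -/

namespace Cannonball

open Finset Complex

theorem norm_sum_range_e_le (f : ℕ → ℝ) (N : ℕ) : ‖∑ i ∈ range N, e (f i)‖ ≤ N := by
  refine (norm_sum_le _ _).trans ?_
  simp [norm_e]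

/-- The exponential sum bound for the approximate square roots of the square pyramidal numbers. -/
theorem norm_sum_e_mul_u_le {h : ℝ} (hh : 1 ≤ h) {N : ℕ} (hN : 1 ≤ N) :
    ‖∑ i ∈ range N, e (h * u i)‖ ≤ 15 * √h * (N : ℝ) ^ (11 / 12 : ℝ) := by
  have hN' : (1 : ℝ) ≤ N := by exact_mod_cast hN
  -- In terms of `T` every exponent below is an integer.
  set T : ℝ := (N : ℝ) ^ (1 / 12 : ℝ) with hT
  have hT1 : 1 ≤ T := Real.one_le_rpow hN' (by norm_num)
  have hT12 : T ^ 12 = N := by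
    rw [hT, ← Real.rpow_natCast, ← Real.rpow_mul (by linarith)]
    norm_num
  have hT11 : (N : ℝ) ^ (11 / 12 : ℝ) = T ^ 11 := by
    rw [hT, ← Real.rpow_natCast, ← Real.rpow_mul (by linarith)]
    norm_num
  have hT0 : 0 < T := by linarith
  rw [hT11]
  set s := √h with hs
  have hs1 : 1 ≤ s := Real.one_le_sqrt.2 hh
  have hsh : s ^ 2 = h := Real.sq_sqrt (by linarith)
  have hT11pos : 0 < T ^ 11 := by positivity
  -- For `√h ≥ T` the trivial bound `N = T¹²` suffices; otherwise `s < T` keeps the initial segment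
  -- of length `M` short.
  rcases le_or_gt T s with hTs | hsT
  · refine (norm_sum_range_e_le _ N).trans ?_
    rw [← hT12]
    nlinarith
  set H := ⌈T ^ 2⌉₊ with hH
  have hH1 : T ^ 2 ≤ H := Nat.le_ceil _
  have hTsq : 1 ≤ T ^ 2 := one_le_pow₀ hT1
  have hH2 : (H : ℝ) ≤ 2 * T ^ 2 := by
    have := Nat.ceil_lt_add_one (show 0 ≤ T ^ 2 by positivity)
    linarith
  have hH0 : 0 < H := by
    have : (0 : ℝ) < H := by linarith
    exact_mod_cast this
  set M := ⌈(h * H) ^ 2⌉₊ with hM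
  have hM1 : (h * H) ^ 2 ≤ M := Nat.le_ceil _
  have hhH : 1 ≤ (h * H) ^ 2 := one_le_pow₀ (by nlinarith)
  have hM0 : 0 < M := by
    have : (0 : ℝ) < M := by linarith
    exact_mod_cast this
  have hM2 : (M : ℝ) ≤ 8 * s * T ^ 11 := by
    have h1 := Nat.ceil_lt_add_one (show 0 ≤ (h * H) ^ 2 by positivity)
    have h2 : (h * H) ^ 2 ≤ (h * (2 * T ^ 2)) ^ 2 := by gcongr
    have h3 : s ^ 3 ≤ T ^ 3 := by gcongr
    have h4 : T ^ 7 ≤ T ^ 11 := pow_le_pow_right₀ hT1 (by norm_num)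
    calc (M : ℝ) ≤ 2 * (h * H) ^ 2 := by linarith
      _ ≤ 2 * (h * (2 * T ^ 2)) ^ 2 := by linarith
      _ = 8 * s * s ^ 3 * T ^ 4 := by rw [← hsh]; ring
      _ ≤ 8 * s * T ^ 3 * T ^ 4 := by gcongr
      _ = 8 * s * T ^ 7 := by ring
      _ ≤ 8 * s * T ^ 11 := by gcongr
  rcases le_or_gt N M with hNM | hMN
  · refine (norm_sum_range_e_le _ N).trans ?_
    have : (N : ℝ) ≤ M := by exact_mod_cast hNM
    nlinarith
  obtain ⟨L, hNL⟩ := Nat.exists_eq_add_of_le hMN.le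
  have hL : (M : ℝ) + L = T ^ 12 := by rw [hT12, hNL, Nat.cast_add]
  have hL' : (L : ℝ) ≤ T ^ 12 := by
    have : (0 : ℝ) ≤ M := Nat.cast_nonneg M
    linarith
  have hvdc := norm_sum_le_of_correlation_le (z := fun i => e (h * u (M + i))) (fun _ => norm_e _)
    L H hH0 (by positivity) (fun j j' hj hjH => norm_sum_correlation_le hh hM1 hM0 L hj hjH)
  have hB : √((M : ℝ) + L + H) ≤ 2 * T ^ 6 := by
    refine Real.sqrt_le_iff.2 ⟨by positivity, ?_⟩
    have : T ^ 2 ≤ T ^ 12 := pow_le_pow_right₀ hT1 (by norm_num)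
    nlinarith
  -- The diagonal contributes `T²²` and the correlations `5 T¹⁸`. With `M ≤ 8 s T¹¹` and `2H ≤ 4
  -- T²`, the total constant is `8 + 4 + 3 = 15`.
  have hroot : √((L : ℝ) ^ 2 / H + L * (5 / 2 * √((M : ℝ) + L + H))) ≤ 3 * T ^ 11 := by
    refine Real.sqrt_le_iff.2 ⟨by positivity, ?_⟩
    have h1 : (L : ℝ) ^ 2 / H ≤ (T ^ 12) ^ 2 / T ^ 2 := by gcongr
    have h2 : (T ^ 12) ^ 2 / T ^ 2 = T ^ 22 := by field_simp
    have h3 : (L : ℝ) * (5 / 2 * √((M : ℝ) + L + H)) ≤ T ^ 12 * (5 / 2 * (2 * T ^ 6)) := by gcongr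
    have h4 : T ^ 18 ≤ T ^ 22 := pow_le_pow_right₀ hT1 (by norm_num)
    nlinarith
  have h2 : T ^ 2 ≤ T ^ 11 := pow_le_pow_right₀ hT1 (by norm_num)
  rw [hNL, sum_range_add]
  refine (norm_add_le _ _).trans ?_
  have h1 := norm_sum_range_e_le (fun i => h * u i) M
  nlinarith

end Cannonball

/-! ### Fourier series of the powers of the distance to the nearest integer -/

namespace Cannonball

open Finset Complex MeasureTheory
open scoped Interval

theorem hasDerivAt_e_mul (h x : ℝ) :
    HasDerivAt (fun x : ℝ => e (h * x)) (2 * Real.pi * h * Complex.I * e (h * x)) x := by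
  have h1 : HasDerivAt (fun x : ℝ => (2 * Real.pi * h * Complex.I : ℂ) * (x : ℂ))
      (2 * Real.pi * h * Complex.I * 1) x := by
    exact (Complex.ofRealCLM.hasDerivAt (x := x)).const_mul (2 * Real.pi * h * Complex.I : ℂ)
  have h2 := h1.cexp
  have h3 : ∀ y : ℝ, e (h * y) = Complex.exp (2 * Real.pi * h * Complex.I * y) := fun y => by
    rw [e]; congr 1; push_cast; ring
  simp only [h3]
  refine h2.congr_deriv ?_
  ring

theorem continuous_e_mul (h : ℝ) : Continuous fun x : ℝ => e (h * x) :=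
  continuous_iff_continuousAt.2 fun x => (hasDerivAt_e_mul h x).continuousAt

/-- Integration by parts. For `j = 0` the factor `j` kills the term with the truncated exponent, and
`0 ^ j = 1` is the boundary value at `0`. -/
theorem integral_pow_mul_e (h : ℝ) (hh : h ≠ 0) (j : ℕ) :
    ∫ x in (0 : ℝ)..(1 / 2), (x : ℂ) ^ j * e (h * x)
      = ((1 / 2) ^ j * e (h / 2) - 0 ^ j
          - j * ∫ x in (0 : ℝ)..(1 / 2), (x : ℂ) ^ (j - 1) * e (h * x))
        / (2 * Real.pi * h * Complex.I) := by
  have hω : (2 * Real.pi * h * Complex.I : ℂ) ≠ 0 := by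
    have := Real.pi_ne_zero
    simp [hh, this]
  have hd : ∀ x ∈ [[(0 : ℝ), 1 / 2]], HasDerivAt (fun x : ℝ => (x : ℂ) ^ j) (j * (x : ℂ) ^ (j - 1)) x := by
    intro x _
    exact (hasDerivAt_pow j (x : ℂ)).comp_ofReal
  have hibp := intervalIntegral.integral_mul_deriv_eq_deriv_mul hd
    (fun x _ => hasDerivAt_e_mul h x)
    (Continuous.intervalIntegrable (by fun_prop) _ _)
    (((continuous_e_mul h).const_mul _).intervalIntegrable _ _)
  rw [eq_div_iff hω, ← intervalIntegral.integral_mul_const,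
    ← intervalIntegral.integral_const_mul]
  have h1 : ∀ x : ℝ, (x : ℂ) ^ j * e (h * x) * (2 * Real.pi * h * Complex.I)
      = (x : ℂ) ^ j * (2 * Real.pi * h * Complex.I * e (h * x)) := fun x => by ring
  simp only [h1, ← mul_assoc] at hibp ⊢
  rw [hibp]
  simp [e, div_eq_mul_inv]

theorem norm_integral_pow_mul_e_le_one (h : ℝ) (j : ℕ) :
    ‖∫ x in (0 : ℝ)..(1 / 2), (x : ℂ) ^ j * e (h * x)‖ ≤ 1 / 2 := by
  have h1 := intervalIntegral.norm_integral_le_of_norm_le_const (a := (0 : ℝ)) (b := 1 / 2)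
    (f := fun x : ℝ => (x : ℂ) ^ j * e (h * x)) (C := 1) ?_
  · refine h1.trans ?_
    rw [sub_zero, abs_of_pos] <;> norm_num
  · intro x hx
    rw [Set.uIoc_of_le (by norm_num)] at hx
    rw [norm_mul, norm_e, mul_one, norm_pow, Complex.norm_real, Real.norm_eq_abs,
      abs_of_pos hx.1]
    exact pow_le_one₀ hx.1.le (by linarith [hx.2])

theorem norm_integral_pow_mul_e_le (h : ℝ) (hh : h ≠ 0) (j : ℕ) :
    ‖∫ x in (0 : ℝ)..(1 / 2), (x : ℂ) ^ j * e (h * x)‖ ≤ (2 + j) / |h| := by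
  rw [integral_pow_mul_e h hh, norm_div]
  have hden : ‖(2 * Real.pi * h * Complex.I : ℂ)‖ = 2 * Real.pi * |h| := by
    simp [abs_of_pos Real.pi_pos]
  have hnum : ‖((1 / 2) ^ j * e (h / 2) - 0 ^ j
      - j * ∫ x in (0 : ℝ)..(1 / 2), (x : ℂ) ^ (j - 1) * e (h * x) : ℂ)‖ ≤ 2 + j := by
    have h1 : ‖((1 / 2) ^ j * e (h / 2) : ℂ)‖ ≤ 1 := by
      rw [norm_mul, norm_e, mul_one, norm_pow]
      exact pow_le_one₀ (norm_nonneg _) (by norm_num)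
    have h2 : ‖(0 ^ j : ℂ)‖ ≤ 1 := by
      rw [norm_pow, norm_zero]
      exact pow_le_one₀ le_rfl zero_le_one
    have h3 : ‖(j * ∫ x in (0 : ℝ)..(1 / 2), (x : ℂ) ^ (j - 1) * e (h * x) : ℂ)‖ ≤ j := by
      rw [norm_mul, Complex.norm_natCast]
      have := norm_integral_pow_mul_e_le_one h (j - 1)
      have hj : (0 : ℝ) ≤ j := Nat.cast_nonneg j
      nlinarith
    refine (norm_sub_le _ _).trans ?_
    have := norm_sub_le ((1 / 2) ^ j * e (h / 2) : ℂ) (0 ^ j)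
    linarith
  rw [hden]
  have hpi := Real.pi_gt_three
  have hh' : 0 < |h| := abs_pos.2 hh
  refine div_le_div₀ (by positivity) hnum hh' ?_
  nlinarith

/-- The boundary terms at `1/2` cancel because `e(h/2) = e(-h/2)` for integral `h`, and those at `0`
vanish because `k > 0`. What remains is `1/h` times integrals that are `O(1/h)`. -/
theorem norm_integral_pow_mul_e_add_le (h : ℤ) (hh : h ≠ 0) (k : ℕ) (hk : 0 < k) :
    ‖(∫ x in (0 : ℝ)..(1 / 2), (x : ℂ) ^ k * e (h * x))
      + ∫ x in (0 : ℝ)..(1 / 2), (x : ℂ) ^ k * e (-h * x)‖ ≤ 2 * k * (k + 1) / (h : ℝ) ^ 2 := by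
  have hhR : (h : ℝ) ≠ 0 := by exact_mod_cast hh
  have hhC : (h : ℂ) ≠ 0 := by exact_mod_cast hh
  have hpiC : (Real.pi : ℂ) ≠ 0 := by exact_mod_cast Real.pi_ne_zero
  have hper : e (h / 2) = e (-h / 2) := by
    have h1 : (h : ℝ) / 2 = -h / 2 + h := by ring
    have h2 : e h = 1 := by
      rw [e, Complex.exp_eq_one_iff]
      exact ⟨h, by push_cast; ring⟩
    rw [h1, e_add, h2, mul_one]
  set J := ∫ x in (0 : ℝ)..(1 / 2), (x : ℂ) ^ (k - 1) * e (h * x) with hJ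
  set J' := ∫ x in (0 : ℝ)..(1 / 2), (x : ℂ) ^ (k - 1) * e (-h * x) with hJ'
  have hsum : (∫ x in (0 : ℝ)..(1 / 2), (x : ℂ) ^ k * e (h * x))
      + ∫ x in (0 : ℝ)..(1 / 2), (x : ℂ) ^ k * e (-h * x)
      = k * (J' - J) / (2 * Real.pi * h * Complex.I) := by
    rw [integral_pow_mul_e h hhR, integral_pow_mul_e (-h) (neg_ne_zero.2 hhR), hper,
      zero_pow hk.ne', ← hJ, ← hJ']
    push_cast
    field_simp
    ring
  have hk1 : ((k - 1 : ℕ) : ℝ) = k - 1 := by rw [Nat.cast_sub hk, Nat.cast_one]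
  have h1 := norm_integral_pow_mul_e_le h hhR (k - 1)
  have h2 := norm_integral_pow_mul_e_le (-h) (neg_ne_zero.2 hhR) (k - 1)
  rw [abs_neg] at h2
  have h3 : ‖J' - J‖ ≤ 2 * ((k + 1) / |(h : ℝ)|) := by
    refine (norm_sub_le _ _).trans ?_
    rw [hk1, show (2 + ((k : ℝ) - 1)) = k + 1 by ring] at h1 h2
    linarith
  have hden : ‖(2 * Real.pi * h * Complex.I : ℂ)‖ = 2 * Real.pi * |(h : ℝ)| := by
    simp [abs_of_pos Real.pi_pos]
  have hh' : 0 < |(h : ℝ)| := abs_pos.2 hhR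
  have hpi := Real.pi_gt_three
  rw [hsum, norm_div, norm_mul, Complex.norm_natCast, hden, ← sq_abs]
  calc (k : ℝ) * ‖J' - J‖ / (2 * Real.pi * |(h : ℝ)|)
      ≤ k * (2 * ((k + 1) / |(h : ℝ)|)) / |(h : ℝ)| := by
        gcongr
        nlinarith
    _ = 2 * k * (k + 1) / |(h : ℝ)| ^ 2 := by field_simp

/-- The `k`-th power of the distance to the nearest integer. -/
noncomputable def distPow (k : ℕ) : C(UnitAddCircle, ℂ) where
  toFun t := ((‖t‖ ^ k : ℝ) : ℂ)
  continuous_toFun := by fun_prop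

theorem distPow_apply (k : ℕ) (x : ℝ) :
    distPow k (x : UnitAddCircle) = ((|x - round x| ^ k : ℝ) : ℂ) := by
  rw [← UnitAddCircle.norm_eq]; rfl

theorem fourier_eq_e (h : ℤ) (x : ℝ) : fourier h (x : UnitAddCircle) = e (h * x) := by
  rw [fourier_coe_apply, e]
  congr 1
  push_cast
  ring

/-- On the fundamental domain `[-1/2, 1/2]` the distance is `|x|`; the two halves are then folded
together. -/
theorem fourierCoeff_distPow (k : ℕ) (h : ℤ) :
    fourierCoeff (distPow k) h = (∫ x in (0 : ℝ)..(1 / 2), (x : ℂ) ^ k * e (h * x))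
      + ∫ x in (0 : ℝ)..(1 / 2), (x : ℂ) ^ k * e (-h * x) := by
  have hint : ∀ g : ℝ, Continuous fun x : ℝ => (x : ℂ) ^ k * e (g * x) := fun g =>
    Continuous.mul (by fun_prop) (continuous_e_mul g)
  set F : ℝ → ℂ := fun x => ((|x| ^ k : ℝ) : ℂ) * e (-h * x) with hF
  have hFc : Continuous F := Continuous.mul (by fun_prop) (continuous_e_mul _)
  rw [fourierCoeff_eq_intervalIntegral _ _ (-(1 / 2))]
  have h1 : ∫ x in (-(1 / 2) : ℝ)..(-(1 / 2) + 1), fourier (-h) (x : UnitAddCircle) • distPow k x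
      = ∫ x in (-(1 / 2) : ℝ)..(1 / 2), F x := by
    rw [show (-(1 / 2) + 1 : ℝ) = 1 / 2 by norm_num]
    refine intervalIntegral.integral_congr fun x hx => ?_
    rw [Set.uIcc_of_le (by norm_num)] at hx
    have hn : ‖(x : UnitAddCircle)‖ = |x| := by
      rw [AddCircle.norm_coe_eq_abs_iff 1 one_ne_zero, abs_one]
      exact abs_le.2 hx
    have : distPow k (x : UnitAddCircle) = ((|x| ^ k : ℝ) : ℂ) := by rw [← hn]; rfl
    simp only [hF, fourier_eq_e, this, smul_eq_mul]
    push_cast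
    ring
  rw [h1, one_div_one, one_smul, ← intervalIntegral.integral_add_adjacent_intervals
    (hFc.intervalIntegrable _ 0) (hFc.intervalIntegrable 0 _)]
  congr 1
  · have h2 := intervalIntegral.integral_comp_neg (a := (0 : ℝ)) (b := 1 / 2) F
    rw [neg_zero] at h2
    rw [← h2]
    refine intervalIntegral.integral_congr fun x hx => ?_
    rw [Set.uIcc_of_le (by norm_num)] at hx
    simp only [hF, abs_neg, abs_of_nonneg hx.1, Complex.ofReal_pow, neg_mul_neg]
  · refine intervalIntegral.integral_congr fun x hx => ?_
    rw [Set.uIcc_of_le (by norm_num)] at hx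
    simp only [hF, abs_of_nonneg hx.1, Complex.ofReal_pow]

theorem fourierCoeff_distPow_zero (k : ℕ) :
    fourierCoeff (distPow k) 0 = ((1 / (2 ^ k * (k + 1)) : ℝ) : ℂ) := by
  rw [fourierCoeff_distPow]
  have h1 : ∀ x : ℝ, (x : ℂ) ^ k * e (((0 : ℤ) : ℝ) * x) = ((x ^ k : ℝ) : ℂ) := by
    intro x; simp [e]
  have h2 : ∀ x : ℝ, (x : ℂ) ^ k * e (-((0 : ℤ) : ℝ) * x) = ((x ^ k : ℝ) : ℂ) := by
    intro x; simp [e]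
  simp only [h1, h2]
  rw [intervalIntegral.integral_ofReal, integral_pow, ← Complex.ofReal_add]
  congr 1
  rw [zero_pow (by omega)]
  field_simp
  rw [sub_zero, pow_succ, one_div, inv_pow]
  field_simp
  norm_num

theorem norm_fourierCoeff_distPow_le (k : ℕ) (hk : 0 < k) (h : ℤ) (hh : h ≠ 0) :
    ‖fourierCoeff (distPow k) h‖ ≤ 2 * k * (k + 1) / (h : ℝ) ^ 2 := by
  rw [fourierCoeff_distPow]
  exact norm_integral_pow_mul_e_add_le h hh k hk

theorem hasSum_fourier_distPow (k : ℕ) (hk : 0 < k) (x : ℝ) :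
    HasSum (fun h : ℤ => fourierCoeff (distPow k) h * e (h * x))
      ((|x - round x| ^ k : ℝ) : ℂ) := by
  have hs : Summable (fourierCoeff (distPow k)) := by
    have h1 : Summable fun h : ℤ => 2 * (k : ℝ) * (k + 1) * (1 / (h : ℝ) ^ 2) :=
      (Real.summable_one_div_int_pow.2 one_lt_two).mul_left _
    refine Summable.of_norm_bounded_eventually h1 ?_
    rw [Filter.eventually_cofinite]
    refine (Set.finite_singleton (0 : ℤ)).subset fun h hh => ?_
    by_contra h0
    refine hh ((norm_fourierCoeff_distPow_le k hk h h0).trans_eq ?_)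
    ring
  have := has_pointwise_sum_fourier_series_of_summable hs (x : UnitAddCircle)
  simp only [fourier_eq_e, distPow_apply, smul_eq_mul] at this
  exact this

end Cannonball

/-! ### Equidistribution of `u`, partial summation and sums of powers -/

namespace Cannonball

open Finset Complex

theorem norm_sum_e_int_mul_u_le {h : ℤ} (hh : h ≠ 0) {N : ℕ} (hN : 1 ≤ N) :
    ‖∑ i ∈ range N, e (h * u i)‖ ≤ 15 * √|(h : ℝ)| * (N : ℝ) ^ (11 / 12 : ℝ) := by
  have h1 : 1 ≤ |(h : ℝ)| := by exact_mod_cast Int.one_le_abs hh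
  refine le_of_eq_of_le ?_ (norm_sum_e_mul_u_le h1 hN)
  rcases abs_choice (h : ℝ) with h2 | h2
  · rw [h2]
  · rw [h2, ← Complex.norm_conj, map_sum]
    simp only [conj_e, neg_mul]

/-- The `k`-th power of the distance to the nearest integer has its expected mean along `u`. -/
theorem exists_sum_distPow_u_le (k : ℕ) (hk : 0 < k) :
    ∃ C : ℝ, 0 ≤ C ∧ ∀ N : ℕ,
      |∑ i ∈ range N, (|u i - round (u i)| ^ k - 1 / (2 ^ k * (k + 1)))|
        ≤ C * (N : ℝ) ^ (11 / 12 : ℝ) := by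
  have hsum : Summable fun h : ℤ => |(h : ℝ)| ^ (-(3 / 2) : ℝ) :=
    Real.summable_abs_int_rpow (by norm_num)
  set K : ℝ := ∑' h : ℤ, |(h : ℝ)| ^ (-(3 / 2) : ℝ) with hK
  have hK0 : 0 ≤ K := tsum_nonneg fun h => by positivity
  refine ⟨2 * k * (k + 1) * 15 * K, by positivity, fun N => ?_⟩
  rcases Nat.eq_zero_or_pos N with rfl | hN
  · simp only [range_zero, sum_empty, abs_zero]
    positivity
  set f : ℤ → ℂ := fun h => fourierCoeff (distPow k) h * ∑ i ∈ range N, e (h * u i) with hf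
  have h1 : HasSum f (∑ i ∈ range N, ((|u i - round (u i)| ^ k : ℝ) : ℂ)) := by
    have := hasSum_sum (s := range N) fun i _ => hasSum_fourier_distPow k hk (u i)
    simpa only [hf, mul_sum] using this
  have h0 : f 0 = ∑ i ∈ range N, ((1 / (2 ^ k * (k + 1)) : ℝ) : ℂ) := by
    simp [hf, fourierCoeff_distPow_zero, e, mul_comm]
  -- Removing the frequency `0` subtracts exactly the mean.
  have h2 := h1.sub (hasSum_ite_eq (0 : ℤ) (f 0))
  rw [h0, ← sum_sub_distrib] at h2
  have hbound : ∀ h : ℤ, ‖f h - (if h = 0 then ∑ i ∈ range N, ((1 / (2 ^ k * (k + 1)) : ℝ) : ℂ)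
      else 0)‖ ≤ 2 * k * (k + 1) * 15 * (N : ℝ) ^ (11 / 12 : ℝ) * |(h : ℝ)| ^ (-(3 / 2) : ℝ) := by
    intro h
    split_ifs with hh
    · subst hh
      rw [h0, sub_self, norm_zero]
      positivity
    · have hh' : 0 < |(h : ℝ)| := abs_pos.2 (by exact_mod_cast hh)
      rw [sub_zero, hf, norm_mul]
      have h3 : |(h : ℝ)| ^ (-(3 / 2) : ℝ) = √|(h : ℝ)| / (h : ℝ) ^ 2 := by
        rw [← sq_abs, Real.sqrt_eq_rpow, ← Real.rpow_natCast, ← Real.rpow_sub hh']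
        norm_num
      calc _ ≤ 2 * k * (k + 1) / (h : ℝ) ^ 2 * (15 * √|(h : ℝ)| * (N : ℝ) ^ (11 / 12 : ℝ)) :=
            mul_le_mul (norm_fourierCoeff_distPow_le k hk h hh) (norm_sum_e_int_mul_u_le hh hN)
              (norm_nonneg _) (by positivity)
        _ = _ := by rw [h3]; ring
  have h3 := tsum_of_norm_bounded (hsum.hasSum.mul_left _) hbound
  rw [h2.tsum_eq] at h3
  have h4 : ∑ i ∈ range N, (((|u i - round (u i)| ^ k : ℝ) : ℂ)
      - ((1 / (2 ^ k * (k + 1)) : ℝ) : ℂ))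
      = ((∑ i ∈ range N, (|u i - round (u i)| ^ k - 1 / (2 ^ k * (k + 1))) : ℝ) : ℂ) := by
    push_cast
    rfl
  rw [h4, Complex.norm_real, Real.norm_eq_abs] at h3
  refine h3.trans_eq ?_
  rw [← hK]
  ring

/-- A partial summation bound for monotone weights. -/
theorem abs_sum_mul_le_of_monotone {b d : ℕ → ℝ} (hb : Monotone b) (hb0 : 0 ≤ b 0) {N : ℕ} {E : ℝ}
    (hE : ∀ n ≤ N, |∑ i ∈ range n, d i| ≤ E) : |∑ i ∈ range N, b i * d i| ≤ 2 * b N * E := by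
  -- Passing from `n` to `n + 1` changes this quantity by `b (n + 1) - b n` times a partial sum of
  -- `d`, so the bound telescopes.
  have key : ∀ n ≤ N, |∑ i ∈ range n, b i * d i - b n * ∑ i ∈ range n, d i| ≤ (b n - b 0) * E := by
    intro n
    induction n with
    | zero => simp
    | succ n ih =>
      intro hn
      have h1 : ∑ i ∈ range (n + 1), b i * d i - b (n + 1) * ∑ i ∈ range (n + 1), d i
          = (∑ i ∈ range n, b i * d i - b n * ∑ i ∈ range n, d i)
            - (b (n + 1) - b n) * ∑ i ∈ range (n + 1), d i := by
        rw [sum_range_succ, sum_range_succ]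
        ring
      have h2 : 0 ≤ b (n + 1) - b n := sub_nonneg.2 (hb n.le_succ)
      have h3 := mul_le_mul_of_nonneg_left (hE (n + 1) hn) h2
      rw [h1]
      refine (abs_sub _ _).trans ?_
      rw [abs_mul, abs_of_nonneg h2]
      linarith [ih (by omega)]
  have h1 := key N le_rfl
  have hbN : 0 ≤ b N := hb0.trans (hb N.zero_le)
  have hE0 : 0 ≤ E := (abs_nonneg _).trans (hE N le_rfl)
  have h2 : |b N * ∑ i ∈ range N, d i| ≤ b N * E := by
    rw [abs_mul, abs_of_nonneg hbN]
    exact mul_le_mul_of_nonneg_left (hE N le_rfl) hbN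
  have h3 := abs_add_le (∑ i ∈ range N, b i * d i - b N * ∑ i ∈ range N, d i)
    (b N * ∑ i ∈ range N, d i)
  rw [sub_add_cancel] at h3
  nlinarith [mul_nonneg hb0 hE0]

theorem exists_rpow_sub_rpow_eq {p x y : ℝ} (hp : 0 ≤ p) (hxy : x < y) :
    ∃ ξ, x ≤ ξ ∧ ξ ≤ y ∧ y ^ (p + 1) / (p + 1) - x ^ (p + 1) / (p + 1) = ξ ^ p * (y - x) := by
  have hd : ∀ t, HasDerivAt (fun t : ℝ => t ^ (p + 1) / (p + 1)) (t ^ p) t := by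
    intro t
    have := (Real.hasDerivAt_rpow_const (x := t) (p := p + 1) (Or.inr (by linarith))).div_const
      (p + 1)
    refine this.congr_deriv ?_
    rw [add_sub_cancel_right]
    field_simp
  obtain ⟨ξ, ⟨h1, h2⟩, h3⟩ := exists_hasDerivAt_eq_slope _ _ hxy
    (fun t _ => (hd t).continuousAt.continuousWithinAt) (fun t _ => hd t)
  refine ⟨ξ, h1.le, h2.le, ?_⟩
  rw [h3, div_mul_cancel₀ _ (sub_ne_zero.2 hxy.ne')]

/-- The midpoint rule for a power. -/
theorem abs_sum_rpow_sub_le {p : ℝ} (hp : 0 ≤ p) (N : ℕ) :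
    |∑ i ∈ range N, ((i : ℝ) + 1 / 2) ^ p - (N : ℝ) ^ (p + 1) / (p + 1)| ≤ (N : ℝ) ^ p := by
  induction N with
  | zero =>
    rw [range_zero, sum_empty, Nat.cast_zero, Real.zero_rpow (by linarith), zero_div, sub_zero,
      abs_zero]
    positivity
  | succ N ih =>
    have hN : (0 : ℝ) ≤ N := Nat.cast_nonneg N
    obtain ⟨ξ, h1, h2, h3⟩ := exists_rpow_sub_rpow_eq hp (lt_add_one (N : ℝ))
    rw [add_sub_cancel_left, mul_one] at h3
    rw [sum_range_succ, Nat.cast_succ]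
    -- The new summand and the new integral both lie between `N^p` and `(N+1)^p`, so the error grows
    -- by at most their difference.
    have h4 : (N : ℝ) ^ p ≤ ξ ^ p := Real.rpow_le_rpow hN h1 hp
    have h5 : ξ ^ p ≤ ((N : ℝ) + 1) ^ p := Real.rpow_le_rpow (hN.trans h1) h2 hp
    have h6 : (N : ℝ) ^ p ≤ ((N : ℝ) + 1 / 2) ^ p := Real.rpow_le_rpow hN (by linarith) hp
    have h7 : ((N : ℝ) + 1 / 2) ^ p ≤ ((N : ℝ) + 1) ^ p :=
      Real.rpow_le_rpow (by linarith) (by linarith) hp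
    rw [abs_le] at ih ⊢
    constructor <;> linarith [ih.1, ih.2]

theorem abs_sum_rpow_sub_rpow_le {p x : ℝ} (hp : 0 ≤ p) (hx : 0 ≤ x) :
    |∑ i ∈ range (⌊x⌋₊ + 1), ((i : ℝ) + 1 / 2) ^ p - x ^ (p + 1) / (p + 1)|
      ≤ 2 * ((⌊x⌋₊ : ℝ) + 1) ^ p := by
  have h1 := abs_sum_rpow_sub_le hp (⌊x⌋₊ + 1)
  rw [Nat.cast_succ] at h1
  have hlt := Nat.lt_floor_add_one x
  have hle := Nat.floor_le hx
  obtain ⟨ξ, h2, h3, h4⟩ := exists_rpow_sub_rpow_eq hp hlt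
  have h5 : ξ ^ p ≤ ((⌊x⌋₊ : ℝ) + 1) ^ p := Real.rpow_le_rpow (hx.trans h2) h3 hp
  have h6 : 0 ≤ ξ ^ p := Real.rpow_nonneg (hx.trans h2) p
  have h7 : 0 ≤ ξ ^ p * ((⌊x⌋₊ : ℝ) + 1 - x) := mul_nonneg h6 (by linarith)
  have h8 : ξ ^ p * ((⌊x⌋₊ : ℝ) + 1 - x) ≤ ξ ^ p := mul_le_of_le_one_right h6 (by linarith)
  rw [abs_le] at h1 ⊢
  constructor <;> linarith [h1.1, h1.2]

end Cannonball

/-! ### Comparing `a n` with `2 u(n) ‖u(n)‖` -/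

namespace Cannonball

open Finset

theorem pyramidal_eq (n : ℕ) :
    (pyramidal n : ℝ) = ((n : ℝ) + 1 / 2) ^ 3 / 3 - ((n : ℝ) + 1 / 2) / 12 := by
  induction n with
  | zero => norm_num [pyramidal]
  | succ n ih =>
    have h : pyramidal (n + 1) = pyramidal n + (n + 1) ^ 2 :=
      sum_Icc_succ_top (Nat.le_add_left 1 n) _
    rw [h]
    push_cast
    rw [ih]
    ring

theorem isClosestSquare_closestSquare (N : ℕ) : IsClosestSquare N (closestSquare N) :=
  (existsUnique_isClosestSquare N).choose_spec.1

theorem a_le (n t : ℕ) : (a n : ℝ) ≤ |(pyramidal n : ℝ) - t ^ 2| := by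
  have h := (isClosestSquare_closestSquare (pyramidal n)).2 (t * t) ⟨t, rfl⟩
  have h2 : (a n : ℝ) ≤ ((|(pyramidal n : ℤ) - (t * t : ℕ)| : ℤ) : ℝ) := Int.cast_le.2 h
  refine h2.trans_eq ?_
  push_cast
  ring_nf

theorem exists_a_eq (n : ℕ) : ∃ q : ℕ, (a n : ℝ) = |(pyramidal n : ℝ) - q ^ 2| := by
  obtain ⟨q, hq⟩ := (isClosestSquare_closestSquare (pyramidal n)).1
  refine ⟨q, ?_⟩
  rw [a, hq]
  push_cast
  ring_nf

theorem a_nonneg (n : ℕ) : (0 : ℝ) ≤ a n := by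
  obtain ⟨q, hq⟩ := exists_a_eq n
  rw [hq]
  exact abs_nonneg _

theorem a_zero : (a 0 : ℝ) = 0 := by
  refine le_antisymm ((a_le 0 0).trans_eq ?_) (a_nonneg 0)
  simp [pyramidal]

/-- The distance to the closest square in terms of the distance from the square root to the closest
integer. -/
theorem abs_a_sub_le (n : ℕ) :
    |(a n : ℝ) - 2 * √(pyramidal n) * (|√(pyramidal n) - round √(pyramidal n)|)| ≤ 1 / 4 := by
  set y := √(pyramidal n : ℝ) with hy
  have hy0 : 0 ≤ y := Real.sqrt_nonneg _
  have hy2 : y ^ 2 = pyramidal n := Real.sq_sqrt (Nat.cast_nonneg _)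
  have hhalf : |y - round y| ≤ 1 / 2 := abs_sub_round y
  set d := |y - round y| with hd
  have hd0 : 0 ≤ d := abs_nonneg _
  -- With `d ≤ 1/2`, every square is at distance at least `2yd - d²` from `y²`, and the square of
  -- `round y` is at distance at most `2yd + d²`; hence the `1/4`.
  rw [abs_le]
  constructor
  · obtain ⟨q, hq⟩ := exists_a_eq n
    have hq' : d ≤ |y - q| := by exact_mod_cast round_le y q
    have hq0 : (0 : ℝ) ≤ q := Nat.cast_nonneg q
    rw [hq, ← hy2]
    rcases le_total y q with h | h
    · rw [abs_sub_comm, abs_of_nonneg (sub_nonneg.2 h)] at hq'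
      have := neg_le_abs (y ^ 2 - (q : ℝ) ^ 2)
      nlinarith
    · rw [abs_of_nonneg (sub_nonneg.2 h)] at hq'
      have := le_abs_self (y ^ 2 - (q : ℝ) ^ 2)
      nlinarith
  · have hr0 : 0 ≤ round y := by
      rw [round_eq]
      exact Int.floor_nonneg.2 (by linarith)
    obtain ⟨t, ht⟩ := Int.eq_ofNat_of_zero_le hr0
    have h := a_le n t
    have hyt : d = |y - t| := by rw [hd, ht]; simp
    have hsum : (0 : ℝ) ≤ y + t := by positivity
    rw [← hy2, show y ^ 2 - (t : ℝ) ^ 2 = (y - t) * (y + t) by ring, abs_mul, ← hyt,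
      abs_of_nonneg hsum] at h
    have h2 := neg_le_abs (y - (t : ℝ))
    rw [← hyt] at h2
    nlinarith

theorem u_nonneg (n : ℕ) : 0 ≤ u n := by
  rw [u, rootApprox]
  positivity

theorem u_sq (n : ℕ) : u n ^ 2 = ((n : ℝ) + 1 / 2) ^ 3 / 3 := by
  rw [u, rootApprox, div_pow, mul_pow, Real.sq_sqrt (by positivity), Real.sq_sqrt (by norm_num)]
  ring

theorem u_eq (n : ℕ) : u n = ((n : ℝ) + 1 / 2) ^ (3 / 2 : ℝ) / (3 : ℝ) ^ (1 / 2 : ℝ) := by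
  rw [u, rootApprox, Real.sqrt_eq_rpow, Real.sqrt_eq_rpow]
  congr 1
  nth_rewrite 1 [← Real.rpow_one ((n : ℝ) + 1 / 2)]
  rw [← Real.rpow_add (by positivity)]
  norm_num

theorem u_le (n : ℕ) : u n ≤ ((n : ℝ) + 1 / 2) ^ (3 / 2 : ℝ) := by
  rw [u_eq]
  exact div_le_self (by positivity) (Real.one_le_rpow (by norm_num) (by norm_num))

theorem monotone_u : Monotone u := by
  intro m n h
  rw [u_eq, u_eq]
  gcongr

/-- The distance to the nearest integer is the quotient norm on the circle, hence 1-Lipschitz. -/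
theorem abs_sub_round_sub_abs_sub_round_le (x y : ℝ) :
    |(|x - round x| - |y - round y|)| ≤ |x - y| := by
  rw [← UnitAddCircle.norm_eq, ← UnitAddCircle.norm_eq]
  refine (abs_norm_sub_norm_le _ _).trans ?_
  rw [← AddCircle.coe_sub, UnitAddCircle.norm_eq]
  simpa using round_le (x - y) 0

theorem abs_a_sub_two_mul_u_le (n : ℕ) :
    |(a n : ℝ) - 2 * u n * (|u n - round (u n)|)| ≤ 2 * ((n : ℝ) + 1 / 2) := by
  have h1 := abs_a_sub_le n
  set y := √(pyramidal n : ℝ) with hy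
  have hy0 : 0 ≤ y := Real.sqrt_nonneg _
  have hy2 : y ^ 2 = pyramidal n := Real.sq_sqrt (Nat.cast_nonneg _)
  rw [pyramidal_eq] at hy2
  have hu0 := u_nonneg n
  have hu2 := u_sq n
  have hL := abs_sub_round_sub_abs_sub_round_le y (u n)
  have hhalf : |y - round y| ≤ 1 / 2 := abs_sub_round y
  have hd0 : 0 ≤ |y - round y| := abs_nonneg _
  set m : ℝ := (n : ℝ) + 1 / 2 with hm
  have hm0 : 1 / 2 ≤ m := by
    have : (0 : ℝ) ≤ n := Nat.cast_nonneg n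
    linarith
  have hle : y ≤ u n := abs_le_of_sq_le_sq' (by linarith) hu0 |>.2
  rw [abs_sub_comm y (u n), abs_of_nonneg (sub_nonneg.2 hle)] at hL
  set δ := u n - y with hδ
  have hδ0 : 0 ≤ δ := sub_nonneg.2 hle
  -- The gap between `u n ^ 2` and `P_n` is exactly `m/12`; it controls both `u n * δ` and, through
  -- `δ² ≤ m/12`, `δ` itself.
  have hprod : δ * (u n + y) = m / 12 := by rw [hδ]; linear_combination hu2 - hy2
  have huδ : u n * δ ≤ m / 12 := by nlinarith
  have hδ1 : δ ≤ 1 / 2 + m / 24 := by nlinarith [sq_nonneg (δ - 1)]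
  have hyδ : δ * |y - round y| ≤ δ * (1 / 2) := mul_le_mul_of_nonneg_left hhalf hδ0
  have hyδ' : 0 ≤ δ * |y - round y| := mul_nonneg hδ0 hd0
  have hy' : y = u n - δ := by rw [hδ]; ring
  rw [abs_le] at h1 hL ⊢
  have h2 := mul_le_mul_of_nonneg_left hL.1 hu0
  have h3 := mul_le_mul_of_nonneg_left hL.2 hu0
  have h4 : y * |y - round y| = u n * |y - round y| - δ * |y - round y| := by
    rw [hδ]; ring
  constructor <;> nlinarith [h1.1, h1.2]

/-- Both bases are `O(X^(3/2))` and differ by `O(X)`, so factoring the difference of powers saves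
`X^(1/2)`. -/
theorem abs_a_pow_sub_le (k : ℕ) (hk : 0 < k) (n : ℕ) {X : ℝ} (hX : (n : ℝ) + 1 ≤ X) :
    |(a n : ℝ) ^ k - (2 * u n * |u n - round (u n)|) ^ k|
      ≤ 2 * k * 3 ^ k * X ^ (3 / 2 * (k : ℝ) - 1 / 2) := by
  have hn : (0 : ℝ) ≤ n := Nat.cast_nonneg n
  have hX1 : 1 ≤ X := by linarith
  have hX0 : 0 < X := by linarith
  have h1 := abs_a_sub_two_mul_u_le n
  have hu := u_le n
  have hu0 := u_nonneg n
  have hhalf : |u n - round (u n)| ≤ 1 / 2 := abs_sub_round _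
  set B := 2 * u n * |u n - round (u n)| with hB
  have hB0 : 0 ≤ B := by positivity
  have hXX : X ≤ X ^ (3 / 2 : ℝ) := by
    conv_lhs => rw [← Real.rpow_one X]
    exact Real.rpow_le_rpow_of_exponent_le hX1 (by norm_num)
  have hmX : ((n : ℝ) + 1 / 2) ^ (3 / 2 : ℝ) ≤ X ^ (3 / 2 : ℝ) :=
    Real.rpow_le_rpow (by positivity) (by linarith) (by norm_num)
  have hB1 : B ≤ X ^ (3 / 2 : ℝ) := by nlinarith
  have hA1 : (a n : ℝ) ≤ 3 * X ^ (3 / 2 : ℝ) := by linarith [(abs_le.1 h1).2]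
  have hmax : max |(a n : ℝ)| |B| ≤ 3 * X ^ (3 / 2 : ℝ) := by
    rw [abs_of_nonneg (a_nonneg n), abs_of_nonneg hB0]
    exact max_le hA1 (by linarith)
  have hmax0 : 0 ≤ max |(a n : ℝ)| |B| := (abs_nonneg _).trans (le_max_left _ _)
  obtain ⟨j, rfl⟩ := Nat.exists_eq_succ_of_ne_zero hk.ne'
  have hpow : X * (X ^ (3 / 2 : ℝ)) ^ j = X ^ (3 / 2 * ((j.succ : ℕ) : ℝ) - 1 / 2) := by
    rw [← Real.rpow_natCast, ← Real.rpow_mul hX0.le]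
    nth_rewrite 1 [← Real.rpow_one X]
    rw [← Real.rpow_add hX0]
    congr 1
    push_cast
    ring
  calc |(a n : ℝ) ^ j.succ - B ^ j.succ|
      ≤ |(a n : ℝ) - B| * (j.succ : ℕ) * max |(a n : ℝ)| |B| ^ (j.succ - 1) :=
        abs_pow_sub_pow_le _ _ _
    _ ≤ (2 * X) * (j.succ : ℕ) * (3 * X ^ (3 / 2 : ℝ)) ^ j := by
        have : |(a n : ℝ) - B| ≤ 2 * X := by linarith
        rw [Nat.succ_sub_one]
        gcongr
    _ = 2 * (j.succ : ℕ) * 3 ^ j * (X * (X ^ (3 / 2 : ℝ)) ^ j) := by rw [mul_pow]; ring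
    _ ≤ 2 * (j.succ : ℕ) * 3 ^ j.succ * X ^ (3 / 2 * ((j.succ : ℕ) : ℝ) - 1 / 2) := by
        rw [hpow]
        gcongr
        · norm_num
        · exact Nat.le_succ j

theorem moment_eq (k : ℕ) (hk : 0 < k) (x : ℝ) :
    moment k x = ∑ n ∈ range (⌊x⌋₊ + 1), (a n : ℝ) ^ k := by
  rw [moment, sum_range_succ', a_zero, zero_pow hk.ne', add_zero, range_eq_Ico,
    sum_Ico_add' (fun n => (a n : ℝ) ^ k) 0 ⌊x⌋₊ 1, zero_add]
  rfl

end Cannonball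

/-! ### Assembly of the asymptotic formula -/

open Cannonball Finset in
theorem theorem1p2 (k : ℕ) (hk : 0 < k) :
    ∃ C : ℝ, 0 < C ∧ ∀ x : ℝ, 1 ≤ x →
      |Cannonball.moment k x
          - x ^ (3 / 2 * (k : ℝ) + 1)
            / ((3 : ℝ) ^ ((k : ℝ) / 2) * (3 / 2 * (k : ℝ) + 1) * ((k : ℝ) + 1))|
        ≤ C * x ^ (3 / 2 * (k : ℝ) + 11 / 12) := by
  obtain ⟨D, hD0, hD⟩ := exists_sum_distPow_u_le k hk
  set p : ℝ := 3 / 2 * (k : ℝ) with hp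
  have hp0 : 0 ≤ p := by positivity
  -- The three summands bound the errors from replacing `a n`, from equidistribution and from the
  -- sum of powers; the last factor comes from `X ≤ 2x`.
  refine ⟨(2 * k * 3 ^ k + 2 * 6 ^ k * D + 2) * 2 ^ (p + 11 / 12), by positivity,
    fun x hx => ?_⟩
  set N := ⌊x⌋₊ with hN
  set X : ℝ := (N : ℝ) + 1 with hX
  have hX1 : 1 ≤ X := by
    have : (0 : ℝ) ≤ N := Nat.cast_nonneg N
    linarith
  have hX0 : 0 < X := by linarith
  have hXx : X ≤ 2 * x := by
    have := Nat.floor_le (show 0 ≤ x by linarith)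
    linarith
  set c : ℝ := 1 / ((3 : ℝ) ^ ((k : ℝ) / 2) * ((k : ℝ) + 1)) with hc
  have hc0 : 0 ≤ c := by positivity
  have hc1 : c ≤ 1 := by
    have h1 : (1 : ℝ) ≤ (3 : ℝ) ^ ((k : ℝ) / 2) := Real.one_le_rpow (by norm_num) (by positivity)
    have h2 : (1 : ℝ) ≤ (k : ℝ) + 1 := by
      have : (0 : ℝ) ≤ k := Nat.cast_nonneg k
      linarith
    exact div_le_one_of_le₀ (one_le_mul_of_one_le_of_one_le h1 h2) (by positivity)
  -- replacing `a n` by its approximation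
  have hfirst : |∑ n ∈ range (N + 1), (a n : ℝ) ^ k
      - ∑ n ∈ range (N + 1), (2 * u n * |u n - round (u n)|) ^ k|
      ≤ 2 * k * 3 ^ k * X ^ (p + 11 / 12) := by
    rw [← sum_sub_distrib]
    refine (abs_sum_le_sum_abs _ _).trans ?_
    have h1 : ∀ n ∈ range (N + 1), |(a n : ℝ) ^ k - (2 * u n * |u n - round (u n)|) ^ k|
        ≤ 2 * k * 3 ^ k * X ^ (p - 1 / 2) := by
      intro n hn
      refine abs_a_pow_sub_le k hk n ?_
      have : (n : ℝ) ≤ N := by exact_mod_cast Nat.lt_succ_iff.1 (mem_range.1 hn)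
      linarith
    refine (sum_le_sum h1).trans ?_
    rw [sum_const, card_range, nsmul_eq_mul, Nat.cast_succ, ← hX]
    have h2 : X * X ^ (p - 1 / 2) ≤ X ^ (p + 11 / 12) := by
      nth_rewrite 1 [← Real.rpow_one X]
      rw [← Real.rpow_add hX0]
      exact Real.rpow_le_rpow_of_exponent_le hX1 (by linarith)
    calc X * (2 * k * 3 ^ k * X ^ (p - 1 / 2)) = 2 * k * 3 ^ k * (X * X ^ (p - 1 / 2)) := by ring
      _ ≤ _ := by gcongr
  -- equidistribution
  have hsecond : |∑ n ∈ range (N + 1), (2 * u n) ^ k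
      * (|u n - round (u n)| ^ k - 1 / (2 ^ k * (k + 1)))| ≤ 2 * 6 ^ k * D * X ^ (p + 11 / 12) := by
    have h1 := abs_sum_mul_le_of_monotone (b := fun n => (2 * u n) ^ k)
      (d := fun n => |u n - round (u n)| ^ k - 1 / (2 ^ k * (k + 1))) (N := N + 1)
      (E := D * X ^ (11 / 12 : ℝ)) ?_ ?_ ?_
    · refine h1.trans ?_
      -- Here `N + 3/2 ≤ 2X` and `2^(3/2) ≤ 3`, whence `6 = 2 * 3`.
      have h2 : 2 * u (N + 1) ≤ 6 * X ^ (3 / 2 : ℝ) := by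
        have h3 := u_le (N + 1)
        have h4 : (((N + 1 : ℕ) : ℝ) + 1 / 2) ^ (3 / 2 : ℝ) ≤ (2 * X) ^ (3 / 2 : ℝ) := by
          refine Real.rpow_le_rpow (by positivity) ?_ (by norm_num)
          push_cast
          linarith
        rw [Real.mul_rpow zero_le_two hX0.le] at h4
        have h5 : (2 : ℝ) ^ (3 / 2 : ℝ) ≤ 3 := by
          rw [show (3 / 2 : ℝ) = 1 + 1 / 2 by norm_num, Real.rpow_add two_pos, Real.rpow_one,
            ← Real.sqrt_eq_rpow]
          have : √(2 : ℝ) ≤ 3 / 2 := Real.sqrt_le_iff.2 ⟨by norm_num, by norm_num⟩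
          linarith
        have h6 : 0 < X ^ (3 / 2 : ℝ) := by positivity
        nlinarith
      have h3 : (2 * u (N + 1)) ^ k ≤ 6 ^ k * X ^ p := by
        have := pow_le_pow_left₀ (mul_nonneg zero_le_two (u_nonneg (N + 1))) h2 k
        rwa [mul_pow 6, ← Real.rpow_natCast (X ^ (3 / 2 : ℝ)), ← Real.rpow_mul hX0.le] at this
      calc 2 * (2 * u (N + 1)) ^ k * (D * X ^ (11 / 12 : ℝ))
          ≤ 2 * (6 ^ k * X ^ p) * (D * X ^ (11 / 12 : ℝ)) := by gcongr
        _ = 2 * 6 ^ k * D * X ^ (p + 11 / 12) := by rw [Real.rpow_add hX0]; ring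
    · intro m n hmn
      have := monotone_u hmn
      have := u_nonneg m
      dsimp only
      gcongr
    · have := u_nonneg 0
      positivity
    · intro n hn
      refine (hD n).trans ?_
      have : (n : ℝ) ≤ X := by
        have : (n : ℝ) ≤ (N + 1 : ℕ) := by exact_mod_cast hn
        rwa [Nat.cast_succ] at this
      gcongr
  -- the main term
  have hmain : ∀ n : ℕ, (2 * u n) ^ k * (1 / (2 ^ k * (k + 1))) = c * ((n : ℝ) + 1 / 2) ^ p := by
    intro n
    rw [u_eq, mul_pow, div_pow, ← Real.rpow_natCast (_ ^ (3 / 2 : ℝ)),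
      ← Real.rpow_natCast (_ ^ (1 / 2 : ℝ)), ← Real.rpow_mul (by positivity),
      ← Real.rpow_mul (by norm_num), hc, show (1 / 2 : ℝ) * k = k / 2 by ring,
      ← hp]
    field_simp
  have hthird := abs_sum_rpow_sub_rpow_le hp0 (show 0 ≤ x by linarith)
  rw [← hN, ← hX] at hthird
  have hthird' : 2 * X ^ p ≤ 2 * X ^ (p + 11 / 12) := by
    have := Real.rpow_le_rpow_of_exponent_le hX1 (show p ≤ p + 11 / 12 by linarith)
    linarith
  have hsplit : ∑ n ∈ range (N + 1), (2 * u n * |u n - round (u n)|) ^ k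
      = ∑ n ∈ range (N + 1), (2 * u n) ^ k * (|u n - round (u n)| ^ k - 1 / (2 ^ k * (k + 1)))
        + c * ∑ n ∈ range (N + 1), ((n : ℝ) + 1 / 2) ^ p := by
    rw [mul_sum, ← sum_add_distrib]
    refine sum_congr rfl fun n _ => ?_
    rw [← hmain, mul_pow]
    ring
  have hterm : x ^ (p + 1) / ((3 : ℝ) ^ ((k : ℝ) / 2) * (p + 1) * ((k : ℝ) + 1))
      = c * (x ^ (p + 1) / (p + 1)) := by
    rw [hc]
    field_simp
  have hfourth : |c * (∑ n ∈ range (N + 1), ((n : ℝ) + 1 / 2) ^ p - x ^ (p + 1) / (p + 1))|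
      ≤ 2 * X ^ (p + 11 / 12) := by
    rw [abs_mul, abs_of_nonneg hc0]
    exact (mul_le_of_le_one_left (abs_nonneg _) hc1).trans (hthird.trans hthird')
  have hXpow : X ^ (p + 11 / 12) ≤ 2 ^ (p + 11 / 12) * x ^ (p + 11 / 12) := by
    rw [← Real.mul_rpow zero_le_two (by linarith)]
    exact Real.rpow_le_rpow hX0.le hXx (by linarith)
  rw [moment_eq k hk, ← hN, hterm, mul_assoc]
  refine le_trans ?_ (mul_le_mul_of_nonneg_left hXpow (by positivity))
  rw [mul_sub, abs_le] at hfourth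
  rw [abs_le] at hfirst hsecond ⊢
  constructor <;> nlinarith [hfirst.1, hfirst.2, hsecond.1, hsecond.2, hfourth.1, hfourth.2]
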